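/- Let $F$ be a field with separable closure $F_s$ and $\Gamma=\mathrm{Gal}(F_s/F)$. For a finite group $G$ with trivial $\Gamma$-action let $H^1(F,G)$ be the set of continuous homomorphisms $\Gamma\to G$ ($G$ discrete) up to conjugation by $G$; a group homomorphism $f\colon G\to H$ induces $f_*\colon H^1(F,G)\to H^1(F,H)$, $[\varphi]\mapsto[f\circ\varphi]$. Let $W(D_4)\subset \mathrm{O}_4(\mathbb R)$ be the Weyl group generated by the reflections with respect to the roots $\pm e_i\pm e_j$ ($1\le i<j\le 4$). An automorphism of $W(D_4)$ is called trialitarian if it is outer (i.e. not inner) of order $3$. For an automorphism $\alpha$ let $\mathrm{Fix}(\alpha)\subset W(D_4)$ be its group of fixed points. Let $\tilde\mu$ and $\tilde\rho$ be the automorphisms $x\mapsto \mu x\mu^{-1}$ and $x\mapsto\rho x\rho^{-1}$ of $W(D_4)$ given by $$\mu=\tfrac12\begin{pmatrix}1&1&1&-1\\1&1&-1&1\\1&-1&1&1\\1&-1&-1&-1\end{pmatrix},\qquad \rho=\tfrac12\begin{pmatrix}-1&1&1&1\\-1&-1&1&-1\\-1&-1&-1&1\\-1&1&-1&-1\end{pmatrix}.$$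 **Theorem.** Let $\alpha$ be any trialitarian automorphism of $W(D_4)$. Every class in $H^1(F,W(D_4))$ that is fixed under $\alpha_*$ lies in the image of $H^1(F,\mathrm{Fix}(\tilde\mu))\to H^1(F,W(D_4))$ or in the image of $H^1(F,\mathrm{Fix}(\tilde\rho))\to H^1(F,W(D_4))$, the maps being induced by the inclusions. Moreover, $\mathrm{Fix}(\tilde\mu)$ is isomorphic to the dihedral group of order $12$, and $\mathrm{Fix}(\tilde\rho)$ is isomorphic to the binary tetrahedral group, i.e. the group of order $24$ of Hurwitz quaternions of norm $1$. -/

import Mathlib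

open scoped Quaternion

/-! ### Nonabelian first cohomology with trivial action -/

namespace TrivialCohomology

variable (Γ G H : Type*) [Group Γ] [TopologicalSpace Γ] [Group G] [Group H]

/-- Cocycles of `Γ` with values in a discrete group `G` on which `Γ` acts trivially: continuous
group homomorphisms `Γ → G`. For the discrete topology on `G`, continuity says that every subset of
`G` has an open preimage. -/
def Cocycle : Type _ := {φ : Γ →* G // IsLocallyConstant φ}

/-- Two cocycles are cohomologous when they are conjugate under `G`. -/
instance cocycleSetoid : Setoid (Cocycle Γ G) where
  r φ ψ := ∃ g : G, ∀ γ : Γ, ψ.1 γ = g * φ.1 γ * g⁻¹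
  iseqv :=
    { refl := fun _ => ⟨1, by simp⟩
      symm := by
        rintro φ ψ ⟨g, h⟩
        exact ⟨g⁻¹, fun γ => by rw [h γ]; group⟩
      trans := by
        rintro φ ψ χ ⟨g, h⟩ ⟨k, h'⟩
        exact ⟨k * g, fun γ => by rw [h' γ, h γ]; group⟩ }

/-- The cohomology set `H¹(Γ, G)` for the trivial action of `Γ` on the discrete group `G`. -/
def H1 : Type _ := Quotient (cocycleSetoid Γ G)

variable {G H}

/-- The map `[φ] ↦ [f ∘ φ]` from `H¹(Γ, G)` to `H¹(Γ, H)` induced by `f : G →* H`. -/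
def H1.map (f : G →* H) : H1 Γ G → H1 Γ H :=
  Quotient.map (fun φ : Cocycle Γ G => (⟨f.comp φ.1, φ.2.comp f⟩ : Cocycle Γ H)) (by
    rintro φ ψ ⟨g, h⟩
    exact ⟨f g, fun γ => by simp [h γ]⟩)

end TrivialCohomology

/-! ### The Weyl group of type `D₄` and its trialitarian automorphisms -/

namespace WeylD4

/-- The roots `± eᵢ ± eⱼ` (`i ≠ j`) of the root system `D₄` in `ℝ⁴`, given by their integral
coordinates. -/
def roots : Set (Fin 4 → ℤ) :=
  {v | ∃ (i j : Fin 4) (ε δ : ℤˣ), i ≠ j ∧ v = Pi.single i (ε : ℤ) + Pi.single j (δ : ℤ)}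

/-- The orthogonal reflections of `ℝ⁴` with respect to the roots. A root `v` has squared length
`2`, so that the reflection is `x ↦ x - ⟨v, x⟩ v`. -/
def reflections : Set (Matrix.orthogonalGroup (Fin 4) ℝ) :=
  {g | ∃ v ∈ roots, (g : Matrix (Fin 4) (Fin 4) ℝ) =
    1 - Matrix.vecMulVec (fun i => (v i : ℝ)) (fun i => (v i : ℝ))}

/-- The Weyl group `W(D₄)`, as the subgroup of `O₄(ℝ)` generated by the reflections with respect to
the roots. -/
def W : Subgroup (Matrix.orthogonalGroup (Fin 4) ℝ) := Subgroup.closure reflections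

/-- The matrix `2μ`. -/
def twoMu : Matrix (Fin 4) (Fin 4) ℤ :=
  !![1, 1, 1, -1; 1, 1, -1, 1; 1, -1, 1, 1; 1, -1, -1, -1]

/-- The matrix `2ρ`. -/
def twoRho : Matrix (Fin 4) (Fin 4) ℤ :=
  !![-1, 1, 1, 1; -1, -1, 1, -1; -1, -1, -1, 1; -1, 1, -1, -1]

/-- Half of an integral matrix `M` with `M Mᵀ = 4`, as an orthogonal matrix. -/
noncomputable def half (M : Matrix (Fin 4) (Fin 4) ℤ) (hM : M * M.transpose = 4) :
    Matrix.orthogonalGroup (Fin 4) ℝ :=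
  ⟨(1 / 2 : ℝ) • M.map (fun n : ℤ => (n : ℝ)), by
    rw [Matrix.mem_orthogonalGroup_iff]
    have h := congrArg (fun A : Matrix (Fin 4) (Fin 4) ℤ => A.map (Int.castRingHom ℝ)) hM
    simp only [Matrix.map_mul, Matrix.transpose_map] at h
    have h4 : (4 : Matrix (Fin 4) (Fin 4) ℤ).map (Int.castRingHom ℝ) = (4 : ℝ) • 1 := by
      ext i j
      fin_cases i <;> fin_cases j <;> simp [Matrix.ofNat_apply]
    rw [h4] at h
    change ((1 / 2 : ℝ) • M.map (Int.castRingHom ℝ)) *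
      ((1 / 2 : ℝ) • M.map (Int.castRingHom ℝ)).transpose = 1
    rw [Matrix.transpose_smul, Matrix.smul_mul, Matrix.mul_smul, ← Matrix.transpose_map, 
      Matrix.transpose_map, h, smul_smul, smul_smul]
    norm_num⟩

theorem half_conj_mem (M : Matrix (Fin 4) (Fin 4) ℤ) (hM : M * M.transpose = 4)
    (h : ∀ v ∈ roots, ∃ w ∈ roots, M.mulVec v = 2 • w)
    {g : Matrix.orthogonalGroup (Fin 4) ℝ} (hg : g ∈ W) :
    half M hM * g * (half M hM)⁻¹ ∈ W := by
  induction hg using Subgroup.closure_induction with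
  | one => simp
  | mul x y _ _ hx hy => simpa [mul_assoc] using W.mul_mem hx hy
  | inv x _ hx => simpa [mul_assoc] using W.inv_mem hx
  | mem x hx =>
    obtain ⟨v, hv, hx⟩ := hx
    obtain ⟨w, hw, hvw⟩ := h v hv
    refine Subgroup.subset_closure ⟨w, hw, ?_⟩
    have key : ((half M hM : Matrix.orthogonalGroup (Fin 4) ℝ) :
        Matrix (Fin 4) (Fin 4) ℝ).mulVec (fun i => (v i : ℝ)) = fun i => (w i : ℝ) := by
      ext i
      have := congrArg (fun n : ℤ => (n : ℝ)) (congrFun hvw i)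
      simp only [Matrix.mulVec, dotProduct, Pi.smul_apply, nsmul_eq_mul] at this
      push_cast at this
      simp only [half, Matrix.mulVec, dotProduct, Matrix.smul_apply, Matrix.map_apply, smul_eq_mul,
        mul_assoc, ← Finset.mul_sum]
      linarith
    have hmul : (half M hM : Matrix (Fin 4) (Fin 4) ℝ) *
        (half M hM : Matrix (Fin 4) (Fin 4) ℝ).transpose = 1 :=
      (Matrix.mem_orthogonalGroup_iff _ _).1 (half M hM).2
    have hinv : (((half M hM)⁻¹ : Matrix.orthogonalGroup (Fin 4) ℝ) : Matrix (Fin 4) (Fin 4) ℝ) =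
      (half M hM : Matrix (Fin 4) (Fin 4) ℝ).transpose := rfl
    rw [Submonoid.coe_mul, Submonoid.coe_mul, hx, hinv, mul_sub, sub_mul, mul_one, hmul]
    rw [Matrix.mul_vecMulVec, Matrix.vecMulVec_mul, Matrix.vecMul_transpose, key]
theorem half_cube (M : Matrix (Fin 4) (Fin 4) ℤ) (hM : M * M.transpose = 4)
    (h3 : M * M * M = 8) : half M hM * half M hM * half M hM = 1 := by
  apply Subtype.ext
  have h := congrArg (fun A : Matrix (Fin 4) (Fin 4) ℤ => A.map (Int.castRingHom ℝ)) h3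
  simp only [Matrix.map_mul] at h
  have h8 : (8 : Matrix (Fin 4) (Fin 4) ℤ).map (Int.castRingHom ℝ) = (8 : ℝ) • 1 := by
    ext i j
    fin_cases i <;> fin_cases j <;> simp [Matrix.ofNat_apply]
  rw [h8] at h
  change ((1 / 2 : ℝ) • M.map (Int.castRingHom ℝ)) * ((1 / 2 : ℝ) • M.map (Int.castRingHom ℝ)) *
    ((1 / 2 : ℝ) • M.map (Int.castRingHom ℝ)) = 1
  simp only [Matrix.smul_mul, Matrix.mul_smul, h, smul_smul]
  norm_num

/-- The automorphism `x ↦ u x u⁻¹` of `W(D₄)` given by an orthogonal matrix `u` of order dividing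
`3` with `u W(D₄) u⁻¹ ⊆ W(D₄)`. -/
def conjAut (u : Matrix.orthogonalGroup (Fin 4) ℝ) (h3 : u * u * u = 1)
    (hW : ∀ g ∈ W, u * g * u⁻¹ ∈ W) : MulAut W where
  toFun g := ⟨u * g * u⁻¹, hW g g.2⟩
  invFun g := ⟨u⁻¹ * g * u, by
    have hu : u⁻¹ = u * u := by rw [inv_eq_iff_mul_eq_one, ← mul_assoc, h3]
    have := hW _ (hW _ g.2)
    have e : u * (u * (g : Matrix.orthogonalGroup (Fin 4) ℝ) * u⁻¹) * u⁻¹ = u⁻¹ * g * u := by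
      have hu' : u = u⁻¹ * u⁻¹ := by rw [← mul_inv_rev, ← hu, inv_inv]
      calc _ = (u * u) * g * (u⁻¹ * u⁻¹) := by group
        _ = _ := by rw [← hu, ← hu']
    rwa [e] at this⟩
  left_inv g := Subtype.ext (by simp [mul_assoc])
  right_inv g := Subtype.ext (by simp [mul_assoc])
  map_mul' g k := Subtype.ext (by simp [mul_assoc])

theorem twoMu_mul_transpose : twoMu * twoMu.transpose = 4 := by decide

theorem twoRho_mul_transpose : twoRho * twoRho.transpose = 4 := by decide

/-- The orthogonal matrix `μ` with `μ³ = 1`, which induces the rotation `α₁ ↦ α₄ ↦ α₃ ↦ α₁`,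
`α₂ ↦ α₂` of the Dynkin diagram of the simple roots `α₁ = e₁ - e₂`, `α₂ = e₂ - e₃`,
`α₃ = e₃ - e₄`, `α₄ = e₃ + e₄`. -/
noncomputable def mu : Matrix.orthogonalGroup (Fin 4) ℝ := half twoMu twoMu_mul_transpose

/-- The orthogonal matrix `ρ` with `ρ³ = 1`, the matrix of the left multiplication by the quaternion
`-(1 + i + j + k) / 2` in the basis `1, i, j, k`. -/
noncomputable def rho : Matrix.orthogonalGroup (Fin 4) ℝ := half twoRho twoRho_mul_transpose

theorem twoMu_roots : ∀ v ∈ roots, ∃ w ∈ roots, twoMu.mulVec v = 2 • w := by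
  have key : ∀ (i j : Fin 4) (ε δ : ℤˣ), i ≠ j → ∃ (k l : Fin 4) (ζ η : ℤˣ), k ≠ l ∧
      twoMu.mulVec (Pi.single i (ε : ℤ) + Pi.single j (δ : ℤ)) =
        2 • (Pi.single k (ζ : ℤ) + Pi.single l (η : ℤ)) := by
    decide +kernel
  rintro _ ⟨i, j, ε, δ, hij, rfl⟩
  obtain ⟨k, l, ζ, η, hkl, h⟩ := key i j ε δ hij
  exact ⟨_, ⟨k, l, ζ, η, hkl, rfl⟩, h⟩

theorem twoRho_roots : ∀ v ∈ roots, ∃ w ∈ roots, twoRho.mulVec v = 2 • w := by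
  have key : ∀ (i j : Fin 4) (ε δ : ℤˣ), i ≠ j → ∃ (k l : Fin 4) (ζ η : ℤˣ), k ≠ l ∧
      twoRho.mulVec (Pi.single i (ε : ℤ) + Pi.single j (δ : ℤ)) =
        2 • (Pi.single k (ζ : ℤ) + Pi.single l (η : ℤ)) := by
    decide +kernel
  rintro _ ⟨i, j, ε, δ, hij, rfl⟩
  obtain ⟨k, l, ζ, η, hkl, h⟩ := key i j ε δ hij
  exact ⟨_, ⟨k, l, ζ, η, hkl, rfl⟩, h⟩

/-- The automorphism `μ̃ : x ↦ μ x μ⁻¹` of `W(D₄)`. -/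
noncomputable def muTilde : MulAut W :=
  conjAut mu (half_cube _ _ (by decide)) fun _ => half_conj_mem _ _ twoMu_roots

/-- The automorphism `ρ̃ : x ↦ ρ x ρ⁻¹` of `W(D₄)`. -/
noncomputable def rhoTilde : MulAut W :=
  conjAut rho (half_cube _ _ (by decide)) fun _ => half_conj_mem _ _ twoRho_roots

/-- Trialitarian automorphisms: the outer (that is, not inner) automorphisms of `W(D₄)` of
order `3`. -/
def IsTrialitarian (α : MulAut W) : Prop :=
  orderOf α = 3 ∧ α ∉ (MulAut.conj : W →* MulAut W).range

/-- The group `Fix(α)` of fixed points of an automorphism `α` of `W(D₄)`. -/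
def Fix (α : MulAut W) : Subgroup W where
  carrier := {g | α g = g}
  one_mem' := map_one α
  mul_mem' := by
    intro a b (ha : α a = a) (hb : α b = b)
    change α (a * b) = a * b
    rw [map_mul, ha, hb]
  inv_mem' := by
    intro a (ha : α a = a)
    change α a⁻¹ = a⁻¹
    rw [map_inv, ha]

end WeylD4

/-- The binary tetrahedral group, as the group of the Hurwitz quaternions of norm `1`. A Hurwitz
quaternion is `(a + b i + c j + d k) / 2` with integers `a, b, c, d` of the same parity. -/
def binaryTetrahedral : Subgroup ℍ[ℝ]ˣ where
  carrier := {q | Quaternion.normSq (q : ℍ[ℝ]) = 1 ∧ ∃ a b c d : ℤ,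
    a ≡ b [ZMOD 2] ∧ a ≡ c [ZMOD 2] ∧ a ≡ d [ZMOD 2] ∧
    (q : ℍ[ℝ]).re = a / 2 ∧ (q : ℍ[ℝ]).imI = b / 2 ∧
    (q : ℍ[ℝ]).imJ = c / 2 ∧ (q : ℍ[ℝ]).imK = d / 2}
  one_mem' := ⟨by simp, 2, 0, 0, 0, by decide, by decide, by decide, by simp⟩
  mul_mem' := by
    rintro p q ⟨hp, a, b, c, d, h1, h2, h3, e0, e1, e2, e3⟩ ⟨hq, a', b', c', d', h1', h2', h3', f0, f1, f2, f3⟩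
    refine ⟨by rw [Units.val_mul, map_mul, hp, hq, one_mul], ?_⟩
    obtain ⟨b, rfl⟩ : ∃ n, b = a + 2 * n := ⟨(b - a) / 2, by have := h1.dvd; omega⟩
    obtain ⟨c, rfl⟩ : ∃ n, c = a + 2 * n := ⟨(c - a) / 2, by have := h2.dvd; omega⟩
    obtain ⟨d, rfl⟩ : ∃ n, d = a + 2 * n := ⟨(d - a) / 2, by have := h3.dvd; omega⟩
    obtain ⟨b', rfl⟩ : ∃ n, b' = a' + 2 * n := ⟨(b' - a') / 2, by have := h1'.dvd; omega⟩
    obtain ⟨c', rfl⟩ : ∃ n, c' = a' + 2 * n := ⟨(c' - a') / 2, by have := h2'.dvd; omega⟩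
    obtain ⟨d', rfl⟩ : ∃ n, d' = a' + 2 * n := ⟨(d' - a') / 2, by have := h3'.dvd; omega⟩
    refine ⟨-a * a' - a * (b' + c' + d') - a' * (b + c + d) - 2 * (b * b' + c * c' + d * d'),
      a * a' + a * (b' + d' - c') + a' * (b + c - d) + 2 * (c * d' - d * c'),
      a * a' + a * (c' + b' - d') + a' * (c + d - b) + 2 * (d * b' - b * d'),
      a * a' + a * (d' + c' - b') + a' * (d + b - c) + 2 * (b * c' - c * b'), ?_, ?_, ?_, ?_⟩
    · refine (Int.modEq_iff_dvd.2 ⟨?_, ?_⟩)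
      exact a * a' + a * (b' + d') + a' * (b + c) + (b * b' + c * c' + d * d') + (c * d' - d * c')
      ring
    · refine (Int.modEq_iff_dvd.2 ⟨?_, ?_⟩)
      exact a * a' + a * (c' + b') + a' * (c + d) + (b * b' + c * c' + d * d') + (d * b' - b * d')
      ring
    · refine (Int.modEq_iff_dvd.2 ⟨?_, ?_⟩)
      exact a * a' + a * (d' + c') + a' * (d + b) + (b * b' + c * c' + d * d') + (b * c' - c * b')
      ring
    · simp only [Units.val_mul, Quaternion.re_mul, Quaternion.imI_mul, Quaternion.imJ_mul,
        Quaternion.imK_mul, e0, e1, e2, e3, f0, f1, f2, f3]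
      push_cast
      refine ⟨?_, ?_, ?_, ?_⟩ <;> ring
  inv_mem' := by
    rintro q ⟨hq, a, b, c, d, h1, h2, h3, e0, e1, e2, e3⟩
    have hinv : ((q⁻¹ : ℍ[ℝ]ˣ) : ℍ[ℝ]) = star (q : ℍ[ℝ]) :=
      Units.inv_eq_of_mul_eq_one_right (by rw [Quaternion.self_mul_star, hq]; simp)
    refine ⟨by rw [hinv, Quaternion.normSq_star, hq], a, -b, -c, -d, ?_, ?_, ?_, ?_⟩
    · exact Int.modEq_iff_dvd.2 (by have := h1.dvd; omega)
    · exact Int.modEq_iff_dvd.2 (by have := h2.dvd; omega)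
    · exact Int.modEq_iff_dvd.2 (by have := h3.dvd; omega)
    · simp [hinv, e0, e1, e2, e3, neg_div]

/-! If the class of a cocycle `φ` is fixed by `α`, then `φ` and `α ∘ φ` are conjugate by some `g`.
Hence `φ` takes its values in the fixed group of `β = conj g ∘ α`, and the theorem becomes a
statement about the finite group `W`: such a fixed group can be conjugated into `Fix muTilde` or
into `Fix rhoTilde`.

Up to inner automorphisms, an automorphism of `W` permutes the simple reflections by a symmetry of
the Dynkin diagram, up to a common central sign (`exists_conj_diagramSymmetry`). Squaring removes
the sign and the symmetries of order 2, so that squares are powers of `muTilde` modulo inner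
automorphisms (`exists_sq_eq`). As `β ^ 2` is not inner, `β ^ 2` or `β ^ 4` has the form `conj u *
muTilde`, and it fixes all that `β` fixes (`exists_fix_le`).

Conjugating `conj u * muTilde` by `conj v` replaces `u` by its twisted conjugate `v * u * (muTilde
v)⁻¹`. Seven representatives suffice (`exists_twistedClass`), and for each of them the fixed group
is conjugate to a subgroup of one of the two target groups (`exists_conj_fix_of_twistedClass`).

The remaining facts are finite checks. Elements of `W` are signed permutations coded by natural
numbers, and `table` lists the code of each element beside those of its images under `muTilde` and
`rhoTilde` (`exists_isCodes`). The isomorphism types of the fixed groups are read off from explicit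
graphs of isomorphisms. -/

namespace WeylD4

/-! ### Signed permutation matrices, encoded by natural numbers -/

/-- The `j`-th digit of `a` in base `8`. -/
def digit (a j : ℕ) : ℕ := a / 8 ^ j % 8

/-- The signed permutation matrix encoded by `a`: if the `j`-th digit of `a` in base `8` is
`p + 4 s` with `p < 4` and `s < 2`, then `eⱼ` is mapped to `(-1) ^ s eₚ`. -/
def signedPerm (a : ℕ) : Matrix (Fin 4) (Fin 4) ℤ :=
  Matrix.of fun i j => if (i : ℕ) = digit a j % 4 then (if digit a j < 4 then 1 else -1) else 0

/-- The image of the signed basis vector encoded by `t` under the signed permutation encoded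
by `a`. -/
def actCode (a t : ℕ) : ℕ := (digit a (t % 4) + t / 4 * 4) % 8

/-- The code of a product of signed permutations. -/
def mulCode (a b : ℕ) : ℕ :=
  actCode a (digit b 0) + 8 * actCode a (digit b 1) + 64 * actCode a (digit b 2) +
    512 * actCode a (digit b 3)

theorem digit_lt (a j : ℕ) : digit a j < 8 := Nat.mod_lt _ (by norm_num)

theorem actCode_lt (a t : ℕ) : actCode a t < 8 := Nat.mod_lt _ (by norm_num)

theorem mulCode_lt (a b : ℕ) : mulCode a b < 4096 := by
  have h0 := actCode_lt a (digit b 0)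
  have h1 := actCode_lt a (digit b 1)
  have h2 := actCode_lt a (digit b 2)
  have h3 := actCode_lt a (digit b 3)
  unfold mulCode
  omega

/-- All four values of `actCode` are below 8, so the sum in base 8 has no carries. -/
theorem digit_mulCode (a b : ℕ) (j : Fin 4) : digit (mulCode a b) j = actCode a (digit b j) := by
  have h0 := actCode_lt a (digit b 0)
  have h1 := actCode_lt a (digit b 1)
  have h2 := actCode_lt a (digit b 2)
  have h3 := actCode_lt a (digit b 3)
  generalize e : mulCode a b = c
  unfold mulCode at e
  fin_cases j
  · change c / 8 ^ 0 % 8 = actCode a (digit b 0)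
    omega
  · change c / 8 ^ 1 % 8 = actCode a (digit b 1)
    omega
  · change c / 8 ^ 2 % 8 = actCode a (digit b 2)
    omega
  · change c / 8 ^ 3 % 8 = actCode a (digit b 3)
    omega

theorem signedPerm_mul (a b : ℕ) : signedPerm (mulCode a b) = signedPerm a * signedPerm b := by
  ext i j
  -- Column `j` of the second factor has a single nonzero entry, in this row.
  rw [Matrix.mul_apply, Finset.sum_eq_single (⟨digit b j % 4, Nat.mod_lt _ (by norm_num)⟩ : Fin 4)]
  · simp only [signedPerm, Matrix.of_apply, digit_mulCode, actCode]
    have h1 := digit_lt b j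
    have h2 := digit_lt a (digit b j % 4)
    generalize digit a (digit b j % 4) = x at *
    generalize digit b j = y at *
    -- The sign of the second factor contributes 0 or 4, which leaves the position modulo 4
    -- unchanged.
    have e : (x + y / 4 * 4) % 8 % 4 = x % 4 := by omega
    rw [e]
    by_cases hi : (i : ℕ) = x % 4
    · by_cases hx : x < 4 <;> by_cases hy : y < 4 <;> simp only [hi, hx, hy, if_true, if_false] <;>
        split_ifs <;> first | rfl | omega
    · simp [hi]
  · intro k _ hk
    have : (k : ℕ) ≠ digit b j % 4 := fun h => hk (Fin.ext h)
    simp [signedPerm, this]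
  · simp

/-- The matrix determines the lowest four digits; the bound `4096 = 8 ^ 4` excludes any others. -/
theorem signedPerm_injOn {a b : ℕ} (ha : a < 4096) (hb : b < 4096)
    (h : signedPerm a = signedPerm b) : a = b := by
  have key : ∀ j : Fin 4, digit a j = digit b j := by
    intro j
    have h1 := digit_lt a j
    have h2 := digit_lt b j
    have := congrFun (congrFun h ⟨digit a j % 4, Nat.mod_lt _ (by norm_num)⟩) j
    simp only [signedPerm, Matrix.of_apply, if_true] at this
    split_ifs at this <;> omega
  have k0 := key 0
  have k1 := key 1
  have k2 := key 2
  have k3 := key 3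
  norm_num [digit] at k0 k1 k2 k3
  omega

/-- The orthogonal matrix `g` is the signed permutation matrix encoded by `a`. -/
def IsCode (g : Matrix.orthogonalGroup (Fin 4) ℝ) (a : ℕ) : Prop :=
  a < 4096 ∧ (g : Matrix (Fin 4) (Fin 4) ℝ) = (signedPerm a).map (Int.castRingHom ℝ)

theorem IsCode.mul {g h : Matrix.orthogonalGroup (Fin 4) ℝ} {a b : ℕ} (hg : IsCode g a)
    (hh : IsCode h b) : IsCode (g * h) (mulCode a b) :=
  ⟨mulCode_lt a b, by rw [Submonoid.coe_mul, hg.2, hh.2, signedPerm_mul, Matrix.map_mul]⟩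

theorem map_castRingHom_injective {m : Type*} {A B : Matrix m m ℤ}
    (h : A.map (Int.castRingHom ℝ) = B.map (Int.castRingHom ℝ)) : A = B := by
  ext i j
  have := congrFun (congrFun h i) j
  simpa using this

theorem IsCode.code_unique {g : Matrix.orthogonalGroup (Fin 4) ℝ} {a b : ℕ} (ha : IsCode g a)
    (hb : IsCode g b) : a = b :=
  signedPerm_injOn ha.1 hb.1 (map_castRingHom_injective (ha.2.symm.trans hb.2))

theorem IsCode.unique {g h : Matrix.orthogonalGroup (Fin 4) ℝ} {a : ℕ} (hg : IsCode g a)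
    (hh : IsCode h a) : g = h :=
  Subtype.ext (hg.2.trans hh.2.symm)

theorem isCode_one : IsCode 1 1672 := by
  refine ⟨by norm_num, ?_⟩
  have : signedPerm 1672 = 1 := by decide +kernel
  rw [this]
  simp

/-- If `M A = B M` for signed permutation matrices `A` and `B`, then conjugation with `M / 2` maps
`A` to `B`. -/
theorem IsCode.half_conj {g : Matrix.orthogonalGroup (Fin 4) ℝ} {a b : ℕ}
    {M : Matrix (Fin 4) (Fin 4) ℤ} (hM : M * M.transpose = 4) (hg : IsCode g a) (hb : b < 4096)
    (h : M * signedPerm a = signedPerm b * M) : IsCode (half M hM * g * (half M hM)⁻¹) b := by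
  refine ⟨hb, ?_⟩
  have hmul : (half M hM : Matrix (Fin 4) (Fin 4) ℝ) *
      ((half M hM)⁻¹ : Matrix.orthogonalGroup (Fin 4) ℝ) = 1 := by
    rw [← Submonoid.coe_mul, mul_inv_cancel, Submonoid.coe_one]
  have key : (half M hM : Matrix (Fin 4) (Fin 4) ℝ) * (signedPerm a).map (Int.castRingHom ℝ) =
      (signedPerm b).map (Int.castRingHom ℝ) * (half M hM : Matrix (Fin 4) (Fin 4) ℝ) := by
    have h' := congrArg (fun A : Matrix (Fin 4) (Fin 4) ℤ => A.map (Int.castRingHom ℝ)) h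
    simp only [Matrix.map_mul] at h'
    change ((1 / 2 : ℝ) • M.map (Int.castRingHom ℝ)) * _ =
      _ * ((1 / 2 : ℝ) • M.map (Int.castRingHom ℝ))
    rw [Matrix.smul_mul, Matrix.mul_smul, h']
  rw [Submonoid.coe_mul, Submonoid.coe_mul, hg.2, key, mul_assoc, hmul, mul_one]

/-! ### The simple reflections -/

/-- The simple roots `e₁ - e₂`, `e₂ - e₃`, `e₃ - e₄`, `e₃ + e₄`. -/
def simpleRoot : Fin 4 → Fin 4 → ℤ :=
  ![![1, -1, 0, 0], ![0, 1, -1, 0], ![0, 0, 1, -1], ![0, 0, 1, 1]]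

/-- The codes of the simple reflections and of their images under `μ̃` and `ρ̃`. -/
def simpleCodes : Fin 4 → ℕ × ℕ × ℕ :=
  ![(1665, 3528, 2191), (1616, 1616, 664), (1224, 1665, 1616), (3528, 1224, 139)]

theorem exists_reflection {a : ℕ} (ha : a < 4096) (v : Fin 4 → ℤ) (hv : v ∈ roots)
    (h : signedPerm a = 1 - Matrix.vecMulVec v v) : ∃ g : W, IsCode g a := by
  have h1 : signedPerm a * (signedPerm a).transpose = 1 := by
    obtain ⟨i, j, ε, δ, hij, rfl⟩ := hv
    rw [h]
    clear h
    revert i j ε δ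
    decide +kernel
  have h2 : (signedPerm a).map (Int.castRingHom ℝ) ∈ Matrix.orthogonalGroup (Fin 4) ℝ := by
    rw [Matrix.mem_orthogonalGroup_iff]
    have := congrArg (fun A : Matrix (Fin 4) (Fin 4) ℤ => A.map (Int.castRingHom ℝ)) h1
    simp only [Matrix.map_mul] at this
    change _ * ((signedPerm a).transpose).map (Int.castRingHom ℝ) = 1
    rw [this]
    simp
  refine ⟨⟨⟨_, h2⟩, Subgroup.subset_closure ⟨v, hv, ?_⟩⟩, ha, rfl⟩
  change (signedPerm a).map (Int.castRingHom ℝ) = _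
  rw [h]
  ext i j
  simp [Matrix.vecMulVec_apply, Matrix.one_apply]

theorem exists_simpleReflection (i : Fin 4) : ∃ g : W, IsCode g (simpleCodes i).1 := by
  refine exists_reflection ?_ (simpleRoot i) ?_ ?_
  · revert i; decide +kernel
  · have : ∀ i, ∃ (k l : Fin 4) (ε δ : ℤˣ), k ≠ l ∧
      simpleRoot i = Pi.single k (ε : ℤ) + Pi.single l (δ : ℤ) := by decide +kernel
    exact this i
  · revert i; decide +kernel

/-- The simple reflections. -/
noncomputable def simple (i : Fin 4) : W := (exists_simpleReflection i).choose

theorem isCode_simple (i : Fin 4) : IsCode (simple i) (simpleCodes i).1 :=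
  (exists_simpleReflection i).choose_spec

theorem isCode_muTilde_simple (i : Fin 4) :
    IsCode (muTilde (simple i)) (simpleCodes i).2.1 :=
  (isCode_simple i).half_conj twoMu_mul_transpose (by revert i; decide +kernel)
    (by revert i; decide +kernel)

theorem isCode_rhoTilde_simple (i : Fin 4) :
    IsCode (rhoTilde (simple i)) (simpleCodes i).2.2 :=
  (isCode_simple i).half_conj twoRho_mul_transpose (by revert i; decide +kernel)
    (by revert i; decide +kernel)

/-! ### Enumeration of the Weyl group -/

/-- Product of triples of codes. -/
def mulCodes (x y : ℕ × ℕ × ℕ) : ℕ × ℕ × ℕ :=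
  (mulCode x.1 y.1, mulCode x.2.1 y.2.1, mulCode x.2.2 y.2.2)

/-- Shortest words in the simple reflections for the elements of `W(D₄)`, by means of coset
representatives for the chain of parabolic subgroups of types `A₁`, `A₂`, `A₃`, `D₄`. -/
def words : List (List (Fin 4)) :=
  [[], [0]].flatMap fun a => [[], [1], [1, 0]].flatMap fun b =>
    [[], [2], [2, 1], [2, 1, 0]].flatMap fun c =>
      [[], [3], [3, 1], [3, 1, 0], [3, 1, 2], [3, 1, 0, 2], [3, 1, 0, 2, 1],
        [3, 1, 0, 2, 1, 3]].map fun d => a ++ (b ++ (c ++ d))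

/-- The codes of the product of a word and of its images under `μ̃` and `ρ̃`. -/
def wordCodes (l : List (Fin 4)) : ℕ × ℕ × ℕ :=
  l.foldr (fun i x => mulCodes (simpleCodes i) x) (1672, 1672, 1672)

/-- The codes of the elements of `W(D₄)` and of their images under `μ̃` and `ρ̃`. -/
def table : List (ℕ × ℕ × ℕ) := words.map wordCodes

/-- The triple `x` consists of the codes of `g` and of its images under `μ̃` and `ρ̃`. -/
def IsCodes (g : W) (x : ℕ × ℕ × ℕ) : Prop :=
  IsCode g x.1 ∧ IsCode (muTilde g) x.2.1 ∧ IsCode (rhoTilde g) x.2.2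

theorem IsCodes.mul {g h : W} {x y : ℕ × ℕ × ℕ} (hg : IsCodes g x) (hh : IsCodes h y) :
    IsCodes (g * h) (mulCodes x y) :=
  ⟨hg.1.mul hh.1, by rw [map_mul]; exact hg.2.1.mul hh.2.1,
    by rw [map_mul]; exact hg.2.2.mul hh.2.2⟩

theorem isCodes_word (l : List (Fin 4)) : IsCodes (l.map simple).prod (wordCodes l) := by
  induction l with
  | nil => exact ⟨isCode_one, by rw [List.map_nil, List.prod_nil, map_one]; exact isCode_one,
      by rw [List.map_nil, List.prod_nil, map_one]; exact isCode_one⟩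
  | cons i l ih =>
    rw [List.map_cons, List.prod_cons]
    exact IsCodes.mul ⟨isCode_simple i, isCode_muTilde_simple i, isCode_rhoTilde_simple i⟩ ih

/-- Stability under left multiplication by the generators makes the list exhaust the group, without
any count of its elements. -/
theorem table_closed : (List.finRange 4).all (fun i => table.all fun x => table.any fun y =>
    mulCode (simpleCodes i).1 x.1 == y.1) = true := by decide +kernel

theorem reflections_subset_table : ∀ (i j : Fin 4) (ε δ : ℤˣ), i ≠ j → ∃ y ∈ table,
    signedPerm y.1 = 1 - Matrix.vecMulVec (Pi.single i (ε : ℤ) + Pi.single j (δ : ℤ))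
      (Pi.single i (ε : ℤ) + Pi.single j (δ : ℤ)) := by decide +kernel

theorem simple_mul_self (i : Fin 4) : simple i * simple i = 1 := by
  refine Subtype.ext (IsCode.unique (a := 1672) ?_ isCode_one)
  have h : mulCode (simpleCodes i).1 (simpleCodes i).1 = 1672 := by revert i; decide +kernel
  rw [← h]
  exact (isCode_simple i).mul (isCode_simple i)

theorem exists_word_of_mem_table {y : ℕ × ℕ × ℕ} (hy : y ∈ table) {g : W} (hg : IsCode g y.1) :
    ∃ l ∈ words, g = (l.map simple).prod := by
  obtain ⟨l, hl, rfl⟩ := List.mem_map.1 hy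
  exact ⟨l, hl, Subtype.ext (hg.unique (isCodes_word l).1)⟩

/-- The reflection in every root occurs in the table, hence is a word in the simple reflections. -/
theorem closure_simple : Subgroup.closure (Set.range simple) = ⊤ := by
  rw [eq_top_iff]
  rintro ⟨x, hx⟩ -
  induction hx using Subgroup.closure_induction with
  | one => exact one_mem _
  | mul x y hx hy hx' hy' => exact mul_mem hx' hy'
  | inv x hx hx' => exact inv_mem hx'
  | mem x hx =>
    obtain ⟨v, ⟨i, j, ε, δ, hij, rfl⟩, h⟩ := hx
    obtain ⟨y, hy, hv⟩ := reflections_subset_table i j ε δ hij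
    obtain ⟨l, -, hl⟩ := exists_word_of_mem_table (g := ⟨x, Subgroup.subset_closure
      ⟨_, ⟨i, j, ε, δ, hij, rfl⟩, h⟩⟩) hy ⟨by
        have : ∀ y ∈ table, y.1 < 4096 := by decide +kernel
        exact this y hy, by
        change (x : Matrix (Fin 4) (Fin 4) ℝ) = _
        rw [h, hv]
        ext k l
        simp [Matrix.vecMulVec_apply, Matrix.one_apply]⟩
    rw [hl]
    refine Subgroup.list_prod_mem _ fun z hz => ?_
    obtain ⟨k, -, rfl⟩ := List.mem_map.1 hz
    exact Subgroup.subset_closure ⟨k, rfl⟩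

theorem exists_word (g : W) : ∃ l ∈ words, g = (l.map simple).prod := by
  have step : ∀ (i : Fin 4) (g : W), (∃ l ∈ words, g = (l.map simple).prod) →
      ∃ l ∈ words, simple i * g = (l.map simple).prod := by
    rintro i _ ⟨l, hl, rfl⟩
    have := table_closed
    simp only [List.all_eq_true, List.any_eq_true, beq_iff_eq] at this
    obtain ⟨y, hy, h⟩ := this i (List.mem_finRange i) _ (List.mem_map_of_mem (f := wordCodes) hl)
    refine exists_word_of_mem_table hy ?_
    rw [← h]
    exact (isCode_simple i).mul (isCodes_word l).1
  have hg : g ∈ Subgroup.closure (Set.range simple) := closure_simple ▸ Subgroup.mem_top g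
  induction hg using Subgroup.closure_induction_left with
  | one => exact ⟨[], by decide, rfl⟩
  | mul_left x hx y _ ih =>
    obtain ⟨i, rfl⟩ := hx
    exact step i y ih
  | inv_mul_cancel x hx y _ ih =>
    obtain ⟨i, rfl⟩ := hx
    rw [inv_eq_of_mul_eq_one_right (simple_mul_self i)]
    exact step i y ih

theorem exists_isCodes (g : W) : ∃ x ∈ table, IsCodes g x := by
  obtain ⟨l, hl, rfl⟩ := exists_word g
  exact ⟨_, List.mem_map_of_mem hl, isCodes_word l⟩

/-- The codes of `g` and of its images under `μ̃` and `ρ̃`. -/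
noncomputable def codes (g : W) : ℕ × ℕ × ℕ := (exists_isCodes g).choose

theorem codes_mem_table (g : W) : codes g ∈ table := (exists_isCodes g).choose_spec.1

theorem isCodes_codes (g : W) : IsCodes g (codes g) := (exists_isCodes g).choose_spec.2

theorem IsCodes.codes_eq {g : W} {x : ℕ × ℕ × ℕ} (h : IsCodes g x) : codes g = x :=
  have h' := isCodes_codes g
  Prod.ext (h'.1.code_unique h.1) (Prod.ext (h'.2.1.code_unique h.2.1) (h'.2.2.code_unique h.2.2))

theorem codes_mul (g h : W) : codes (g * h) = mulCodes (codes g) (codes h) :=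
  ((isCodes_codes g).mul (isCodes_codes h)).codes_eq

theorem codes_one : codes 1 = (1672, 1672, 1672) :=
  (isCodes_word []).codes_eq

theorem codes_simple (i : Fin 4) : codes (simple i) = simpleCodes i :=
  IsCodes.codes_eq ⟨isCode_simple i, isCode_muTilde_simple i, isCode_rhoTilde_simple i⟩

theorem exists_codes_eq {x : ℕ × ℕ × ℕ} (hx : x ∈ table) : ∃ g : W, codes g = x := by
  obtain ⟨l, -, rfl⟩ := List.mem_map.1 hx
  exact ⟨_, (isCodes_word l).codes_eq⟩

/-- The code of an element of `W(D₄)`. -/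
noncomputable def code (g : W) : ℕ := (codes g).1

theorem code_injective : Function.Injective code := fun g h e =>
  Subtype.ext ((isCodes_codes g).1.unique (by
    change IsCode _ (code g)
    rw [e]
    exact (isCodes_codes h).1))

theorem code_mul (g h : W) : code (g * h) = mulCode (code g) (code h) :=
  congrArg Prod.fst (codes_mul g h)

theorem code_muTilde (g : W) : code (muTilde g) = (codes g).2.1 :=
  (isCodes_codes (muTilde g)).1.code_unique (isCodes_codes g).2.1

theorem code_rhoTilde (g : W) : code (rhoTilde g) = (codes g).2.2 :=
  (isCodes_codes (rhoTilde g)).1.code_unique (isCodes_codes g).2.2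

theorem mem_fix_muTilde_iff (g : W) : g ∈ Fix muTilde ↔ (codes g).2.1 = (codes g).1 := by
  rw [← code_muTilde]
  exact code_injective.eq_iff.symm

theorem mem_fix_rhoTilde_iff (g : W) : g ∈ Fix rhoTilde ↔ (codes g).2.2 = (codes g).1 := by
  rw [← code_rhoTilde]
  exact code_injective.eq_iff.symm

theorem exists_code_eq {x : ℕ × ℕ × ℕ} (hx : x ∈ table) : ∃ g : W, code g = x.1 := by
  obtain ⟨g, rfl⟩ := exists_codes_eq hx
  exact ⟨g, rfl⟩

/-! ### Automorphisms of the Weyl group -/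

/-- The word of the longest element of `W(D₄)`. -/
def longestWord : List (Fin 4) := [0, 1, 0, 2, 1, 0, 3, 1, 0, 2, 1, 3]

/-- The element `-1` of `W(D₄)`. -/
noncomputable def negOne : W := (longestWord.map simple).prod

theorem code_one : code 1 = 1672 := congrArg Prod.fst codes_one

theorem code_simple (i : Fin 4) : code (simple i) = (simpleCodes i).1 :=
  congrArg Prod.fst (codes_simple i)

theorem code_negOne : code negOne = 4012 := by
  have h : (wordCodes longestWord).1 = 4012 := by decide +kernel
  rw [← h]
  exact congrArg Prod.fst (isCodes_word longestWord).codes_eq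

/-- The codes 1672 and 4012 are those of `1` and `-1`; the check shows that the center is `{1, -1}`.
-/
theorem table_center : (table.all fun x =>
    (mulCode 4012 x.1 == mulCode x.1 4012) &&
    (!(table.all fun y => mulCode x.1 y.1 == mulCode y.1 x.1) || x.1 == 1672 || x.1 == 4012)) =
      true := by decide +kernel

theorem negOne_mul (g : W) : negOne * g = g * negOne := by
  have h := table_center
  simp only [List.all_eq_true, Bool.and_eq_true, beq_iff_eq] at h
  apply code_injective
  rw [code_mul, code_mul, code_negOne]
  exact (h _ (codes_mem_table g)).1

theorem eq_one_or_eq_negOne {g : W} (hg : ∀ h, g * h = h * g) : g = 1 ∨ g = negOne := by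
  have h := table_center
  simp only [List.all_eq_true, Bool.and_eq_true, Bool.or_eq_true, Bool.not_eq_true', beq_iff_eq]
    at h
  have hc : (table.all fun y => mulCode (codes g).1 y.1 == mulCode y.1 (codes g).1) = true := by
    simp only [List.all_eq_true, beq_iff_eq]
    intro y hy
    obtain ⟨k, hk⟩ := exists_code_eq hy
    have := congrArg code (hg k)
    rwa [code_mul, code_mul, hk] at this
  rcases (h _ (codes_mem_table g)).2 with (h1 | h1) | h1
  · rw [hc] at h1
    exact absurd h1 (by decide)
  · exact Or.inl (code_injective (h1.trans code_one.symm))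
  · exact Or.inr (code_injective (h1.trans code_negOne.symm))

theorem negOne_mul_self : negOne * negOne = 1 := by
  apply code_injective
  rw [code_mul, code_negOne, code_one]
  decide +kernel

/-- An automorphism preserves the center, in which `negOne` is the only nontrivial element. -/
theorem map_negOne (δ : MulAut W) : δ negOne = negOne := by
  rcases eq_one_or_eq_negOne (g := δ negOne) (fun h => by
    obtain ⟨h, rfl⟩ := δ.surjective h
    rw [← map_mul, ← map_mul, negOne_mul]) with h | h
  · have h1 : negOne = 1 := by simpa using h
    have := code_negOne
    rw [h1, code_one] at this
    omega
  · exact h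

theorem mulAut_ext {δ ε : MulAut W} (h : ∀ i, δ (simple i) = ε (simple i)) : δ = ε := by
  have : (δ : W →* W) = ε := by
    refine MonoidHom.eq_of_eqOn_dense closure_simple ?_
    rintro _ ⟨i, rfl⟩
    exact h i
  ext1 x
  exact DFunLike.congr_fun this x

/-- The image of a simple reflection under an automorphism is an involution `b` that satisfies the
braid relation with another involution. This property forces `b` to be conjugate to the reflection
of the branch node (code 1616), up to sign. -/
theorem table_conj_simple : (table.all fun b =>
    !(mulCode b.1 b.1 == 1672 && table.any fun a => a.1 != b.1 && mulCode a.1 a.1 == 1672 &&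
      mulCode a.1 (mulCode b.1 a.1) == mulCode b.1 (mulCode a.1 b.1)) ||
    (table.any fun w => [1672, 4012].any fun e =>
      mulCode w.1 b.1 == mulCode (mulCode e 1616) w.1)) = true := by decide +kernel

/-- The symmetries of the Dynkin diagram of type `D₄`. -/
def diagramSymmetries : List (Fin 4 → Fin 4) :=
  [![0, 1, 2, 3], ![0, 1, 3, 2], ![2, 1, 0, 3], ![2, 1, 3, 0], ![3, 1, 0, 2], ![3, 1, 2, 0]]

/-- The condition on `t` to be an involution different from `b` with `t b t = b t b`. -/
def isBraided (b t : ℕ) : Bool :=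
  mulCode t t == 1672 && t != b && mulCode t (mulCode b t) == mulCode b (mulCode t b)

/-- The condition on `x` and `y` to be distinct and to commute. -/
def isCommuting (x y : ℕ) : Bool := x != y && mulCode x y == mulCode y x

/-- Once the branch node goes to itself up to the sign `e`, the three outer nodes go to distinct
commuting involutions braided with it. The centralizer of the branch reflection suffices to move
these to the outer simple reflections, in some order and with the same sign `e`. -/
theorem table_conj_triple : ([1672, 4012].all fun e =>
    (table.filter fun x => isBraided (mulCode e 1616) x.1).all fun x =>
    (table.filter fun y => isBraided (mulCode e 1616) y.1).all fun y =>
    (table.filter fun z => isBraided (mulCode e 1616) z.1).all fun z =>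
      !(isCommuting x.1 y.1 && isCommuting y.1 z.1 && isCommuting x.1 z.1) ||
      (table.any fun w => mulCode w.1 1616 == mulCode 1616 w.1 && diagramSymmetries.any fun σ =>
        mulCode w.1 x.1 == mulCode (mulCode e (simpleCodes (σ 0)).1) w.1 &&
        mulCode w.1 y.1 == mulCode (mulCode e (simpleCodes (σ 2)).1) w.1 &&
        mulCode w.1 z.1 == mulCode (mulCode e (simpleCodes (σ 3)).1) w.1)) = true := by
  decide +kernel

/-- Words whose products represent the classes of `W(D₄)` for the action
`v ⋆ u = v u μ̃(v)⁻¹`. -/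
def twistedClasses : List (List (Fin 4)) :=
  [[], [3], [3, 1], [3, 1, 2], [2, 3, 1, 0, 2, 1], [2, 1, 3, 1], [2, 1, 3, 1, 0, 2, 1, 3]]

/-- As `v.2.1` is the code of `μ̃(v)`, the equation reads `v u = r μ̃(v)`, that is `v ⋆ u = r`. -/
theorem table_twistedClasses : (table.all fun u => (twistedClasses.map wordCodes).any fun r =>
    table.any fun v => mulCode v.1 u.1 == mulCode r.1 v.2.1) = true := by decide +kernel

/-- The condition `r μ̃(g) = g r` describes the fixed group of `conj r * muTilde`. A single `v` has
to conjugate this whole group into `Fix(μ̃)`, or all of it into `Fix(ρ̃)`. -/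
theorem table_centralizer : ((twistedClasses.map wordCodes).all fun r =>
    table.any fun v =>
      ((table.filter fun g => mulCode r.1 g.2.1 == mulCode g.1 r.1).all fun g =>
        (table.filter fun h => h.2.1 == h.1).any fun h => mulCode h.1 v.1 == mulCode v.1 g.1) ||
      ((table.filter fun g => mulCode r.1 g.2.1 == mulCode g.1 r.1).all fun g =>
        (table.filter fun h => h.2.2 == h.1).any fun h => mulCode h.1 v.1 == mulCode v.1 g.1)) =
      true := by decide +kernel

theorem simple_injective : Function.Injective simple := by
  intro i j h
  have := congrArg code h
  rw [code_simple, code_simple] at this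
  clear h
  revert i j
  decide +kernel

theorem simple_braid (i : Fin 4) :
    simple i * (simple 1 * simple i) = simple 1 * (simple i * simple 1) := by
  apply code_injective
  simp only [code_mul, code_simple]
  revert i
  decide +kernel

theorem simple_comm (i j : Fin 4) (hi : i ≠ 1) (hj : j ≠ 1) :
    simple i * simple j = simple j * simple i := by
  apply code_injective
  simp only [code_mul, code_simple]
  revert i j
  decide +kernel

theorem exists_conj_involution {a b : W} (ha : a * a = 1) (hb : b * b = 1) (hab : a ≠ b)
    (h : a * (b * a) = b * (a * b)) :
    ∃ w e : W, (e = 1 ∨ e = negOne) ∧ w * b * w⁻¹ = e * simple 1 := by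
  have key := table_conj_simple
  simp only [List.all_eq_true, List.any_eq_true, Bool.or_eq_true, Bool.not_eq_true',
    beq_iff_eq] at key
  rcases key _ (codes_mem_table b) with h1 | ⟨x, hx, c, hc, h1⟩
  · exfalso
    rw [Bool.eq_false_iff] at h1
    apply h1
    simp only [Bool.and_eq_true, List.any_eq_true, beq_iff_eq, bne_iff_ne]
    refine ⟨?_, codes a, codes_mem_table a, ⟨fun e => hab (code_injective e), ?_⟩, ?_⟩
    · have := congrArg code hb
      rwa [code_mul, code_one] at this
    · have := congrArg code ha
      rwa [code_mul, code_one] at this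
    · have := congrArg code h
      simp only [code_mul] at this
      exact this
  · obtain ⟨w, hw⟩ := exists_code_eq hx
    obtain ⟨e, he, rfl⟩ : ∃ e : W, (e = 1 ∨ e = negOne) ∧ code e = c := by
      simp only [List.mem_cons, List.not_mem_nil, or_false] at hc
      rcases hc with rfl | rfl
      · exact ⟨1, Or.inl rfl, code_one⟩
      · exact ⟨negOne, Or.inr rfl, code_negOne⟩
    refine ⟨w, e, he, ?_⟩
    rw [mul_inv_eq_iff_eq_mul]
    apply code_injective
    rw [code_mul, code_mul, code_mul, code_simple, hw]
    exact h1

theorem isBraided_code {b t : W} (h1 : t * t = 1) (h2 : t ≠ b) (h3 : t * (b * t) = b * (t * b)) :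
    isBraided (code b) (code t) = true := by
  simp only [isBraided, Bool.and_eq_true, beq_iff_eq, bne_iff_ne, ← code_mul, ← code_one]
  exact ⟨⟨congrArg code h1, code_injective.ne h2⟩, congrArg code h3⟩

theorem isCommuting_code {x y : W} (h1 : x ≠ y) (h2 : x * y = y * x) :
    isCommuting (code x) (code y) = true := by
  simp only [isCommuting, Bool.and_eq_true, beq_iff_eq, bne_iff_ne, ← code_mul]
  exact ⟨code_injective.ne h1, congrArg code h2⟩

/-- Up to inner automorphisms, every automorphism of `W(D₄)` permutes the simple reflections,
up to a common sign. -/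
theorem exists_conj_diagramSymmetry (δ : MulAut W) :
    ∃ w e : W, (e = 1 ∨ e = negOne) ∧ ∃ σ ∈ diagramSymmetries,
      ∀ i, (MulAut.conj w * δ) (simple i) = e * simple (σ i) := by
  have inj : ∀ δ : MulAut W, ∀ i j, i ≠ j → δ (simple i) ≠ δ (simple j) :=
    fun δ i j h e => h (simple_injective (δ.injective e))
  have sq : ∀ (δ : MulAut W) i, δ (simple i) * δ (simple i) = 1 := fun δ i => by
    rw [← map_mul, simple_mul_self, map_one]
  have braid : ∀ (δ : MulAut W) i, δ (simple i) * (δ (simple 1) * δ (simple i)) =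
      δ (simple 1) * (δ (simple i) * δ (simple 1)) := fun δ i => by
    simp only [← map_mul, simple_braid]
  have comm : ∀ (δ : MulAut W) i j, i ≠ 1 → j ≠ 1 →
      δ (simple i) * δ (simple j) = δ (simple j) * δ (simple i) := fun δ i j hi hj => by
    simp only [← map_mul, simple_comm i j hi hj]
  -- The branch node is normalized first; a second conjugation then treats the outer nodes.
  obtain ⟨w, e, he, hw⟩ := exists_conj_involution (sq δ 0) (sq δ 1) (inj δ 0 1 (by decide))
    (braid δ 0)
  set ε : MulAut W := MulAut.conj w * δ with hε
  have h1 : ε (simple 1) = e * simple 1 := hw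
  have hbr : ∀ i, i ≠ 1 → codes (ε (simple i)) ∈
      table.filter fun x => isBraided (mulCode (code e) 1616) x.1 := fun i hi => by
    rw [List.mem_filter]
    refine ⟨codes_mem_table _, ?_⟩
    have := isBraided_code (sq ε i) (inj ε i 1 hi) (braid ε i)
    rw [h1, code_mul, code_simple] at this
    exact this
  have hce : code e ∈ [1672, 4012] := by
    rcases he with rfl | rfl
    · simp [code_one]
    · simp [code_negOne]
  have key := table_conj_triple
  rw [List.all_eq_true] at key
  have key := key _ hce
  rw [List.all_eq_true] at key
  have key := key _ (hbr 0 (by decide))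
  rw [List.all_eq_true] at key
  have key := key _ (hbr 2 (by decide))
  rw [List.all_eq_true] at key
  have key := key _ (hbr 3 (by decide))
  have hcomm : (isCommuting (codes (ε (simple 0))).1 (codes (ε (simple 2))).1 &&
      isCommuting (codes (ε (simple 2))).1 (codes (ε (simple 3))).1 &&
      isCommuting (codes (ε (simple 0))).1 (codes (ε (simple 3))).1) = true := by
    have h := fun i j hi hj hij => isCommuting_code (inj ε i j hij) (comm ε i j hi hj)
    rw [Bool.and_eq_true, Bool.and_eq_true]
    exact ⟨⟨h 0 2 (by decide) (by decide) (by decide), h 2 3 (by decide) (by decide) (by decide)⟩,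
      h 0 3 (by decide) (by decide) (by decide)⟩
  rw [hcomm] at key
  simp only [Bool.not_true, Bool.false_or, List.any_eq_true, Bool.and_eq_true, beq_iff_eq] at key
  obtain ⟨y, hy, hy1, σ, hσ, ⟨hy0, hy2⟩, hy3⟩ := key
  obtain ⟨v, hv⟩ := exists_code_eq hy
  have conj_eq : ∀ i j, mulCode y.1 (code (ε (simple i))) =
      mulCode (mulCode (code e) (simpleCodes j).1) y.1 →
      v * ε (simple i) * v⁻¹ = e * simple j := fun i j h => by
    rw [mul_inv_eq_iff_eq_mul]
    apply code_injective
    rw [code_mul, code_mul, code_mul, code_simple, hv]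
    exact h
  have hσ1 : ∀ σ ∈ diagramSymmetries, σ 1 = 1 := by decide +kernel
  -- The second conjugation commutes with the branch reflection, so it keeps the first
  -- normalization.
  have hv1 : v * simple 1 = simple 1 * v := by
    apply code_injective
    rw [code_mul, code_mul, hv, code_simple]
    exact hy1
  have hve : v * e = e * v := by
    rcases he with rfl | rfl
    · simp
    · exact (negOne_mul v).symm
  refine ⟨v * w, e, he, σ, hσ, fun i => ?_⟩
  rw [map_mul, mul_assoc, ← hε]
  change v * ε (simple i) * v⁻¹ = _
  fin_cases i
  · exact conj_eq _ _ hy0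
  · change v * ε (simple 1) * v⁻¹ = e * simple (σ 1)
    rw [hσ1 σ hσ, h1, mul_inv_eq_iff_eq_mul, ← mul_assoc, hve, mul_assoc, hv1, mul_assoc]
  · exact conj_eq _ _ hy2
  · exact conj_eq _ _ hy3

theorem muTilde_simple (i : Fin 4) : muTilde (simple i) = simple (![3, 1, 0, 2] i) := by
  apply code_injective
  rw [code_muTilde, codes_simple, code_simple]
  revert i
  decide +kernel

/-- The square of an automorphism of `W(D₄)` is, up to inner automorphisms, a power of `μ̃`. -/
theorem exists_sq_eq (δ : MulAut W) : ∃ u : W, δ ^ 2 = MulAut.conj u ∨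
    δ ^ 2 = MulAut.conj u * muTilde ∨ δ ^ 2 = MulAut.conj u * muTilde ^ 2 := by
  obtain ⟨w, e, he, σ, hσ, h⟩ := exists_conj_diagramSymmetry δ
  set ε : MulAut W := MulAut.conj w * δ with hε
  have hεe : ε e = e := by
    rcases he with rfl | rfl
    · exact map_one ε
    · exact map_negOne ε
  have hee : e * e = 1 := by
    rcases he with rfl | rfl
    · exact mul_one 1
    · exact negOne_mul_self
  have hsq : ∀ i, (ε ^ 2) (simple i) = simple (σ (σ i)) := fun i => by
    rw [pow_two, MulAut.mul_apply, h, map_mul, hεe, h, ← mul_assoc, hee, one_mul]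
  have hpow : ε ^ 2 = 1 ∨ ε ^ 2 = muTilde ∨ ε ^ 2 = muTilde ^ 2 := by
    have hmu : ∀ i, (muTilde ^ 2) (simple i) = simple (![3, 1, 0, 2] (![3, 1, 0, 2] i)) :=
      fun i => by rw [pow_two, MulAut.mul_apply, muTilde_simple, muTilde_simple]
    have : ∀ σ ∈ diagramSymmetries, (∀ i, σ (σ i) = i) ∨ (∀ i, σ (σ i) = ![3, 1, 0, 2] i) ∨
      (∀ i, σ (σ i) = ![3, 1, 0, 2] ((![3, 1, 0, 2] : Fin 4 → Fin 4) i)) := by decide +kernel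
    rcases this σ hσ with h | h | h
    · exact Or.inl (mulAut_ext fun i => by rw [hsq, h]; rfl)
    · exact Or.inr (Or.inl (mulAut_ext fun i => by rw [hsq, h, muTilde_simple]))
    · exact Or.inr (Or.inr (mulAut_ext fun i => by rw [hsq, h, hmu]))
  -- Moving `δ` past `conj w` gives `ε ^ 2 = conj (w * δ w) * δ ^ 2`.
  have hδ : ∃ u : W, δ ^ 2 = MulAut.conj u * ε ^ 2 := by
    refine ⟨(w * δ w)⁻¹, ?_⟩
    rw [hε]
    ext1 x
    simp [pow_two, mul_assoc]
  obtain ⟨u, hu⟩ := hδ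
  refine ⟨u, ?_⟩
  rw [hu]
  rcases hpow with h | h | h
  · exact Or.inl (by rw [h, mul_one])
  · exact Or.inr (Or.inl (by rw [h]))
  · exact Or.inr (Or.inr (by rw [h]))

theorem muTilde_cube : muTilde ^ 3 = 1 := by
  refine mulAut_ext fun i => ?_
  rw [pow_succ, pow_two, MulAut.mul_apply, MulAut.mul_apply, muTilde_simple, muTilde_simple,
    muTilde_simple]
  have : ∀ i, ![3, 1, 0, 2] (![3, 1, 0, 2] ((![3, 1, 0, 2] : Fin 4 → Fin 4) i)) = i := by
    decide +kernel
  rw [this]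
  rfl

/-! ### Fixed groups and twisted conjugacy. -/

theorem fix_le_fix_pow (δ : MulAut W) (n : ℕ) : Fix δ ≤ Fix (δ ^ n) := by
  intro g (hg : δ g = g)
  change (δ ^ n) g = g
  induction n with
  | zero => rfl
  | succ n ih => rw [pow_succ, MulAut.mul_apply, hg, ih]

/-- Since `m ^ 4 = m`, one more squaring passes from the class of `m ^ 2` modulo inner automorphisms
to that of `m`. This lets the case of `muTilde ^ 2` be reduced to `muTilde`. -/
theorem conj_mul_sq_mul_self {G : Type*} [Group G] {m : MulAut G} (hm : m ^ 3 = 1) (u : G) :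
    (MulAut.conj u * m ^ 2) * (MulAut.conj u * m ^ 2) = MulAut.conj (u * (m ^ 2) u) * m := by
  have h : m = m ^ 2 * m ^ 2 := by rw [← pow_add, pow_succ, hm, one_mul]
  have h' : ∀ x, m x = (m ^ 2) ((m ^ 2) x) := fun x => by rw [← MulAut.mul_apply, ← h]
  ext1 x
  change _ = MulAut.conj (u * (m ^ 2) u) (m x)
  rw [h' x]
  simp only [MulAut.mul_apply, MulAut.conj_apply, map_mul, map_inv, mul_inv_rev, mul_assoc]

/-- The fixed points of an automorphism with non-inner square are fixed by an automorphism in the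
class of `μ̃` modulo inner automorphisms. -/
theorem exists_fix_le (δ : MulAut W) (hδ : δ ^ 2 ∉ (MulAut.conj : W →* MulAut W).range) :
    ∃ u : W, Fix δ ≤ Fix (MulAut.conj u * muTilde) := by
  obtain ⟨u, h | h | h⟩ := exists_sq_eq δ
  · exact absurd ⟨u, h.symm⟩ hδ
  · exact ⟨u, by rw [← h]; exact fix_le_fix_pow δ 2⟩
  · refine ⟨u * (muTilde ^ 2) u, ?_⟩
    have h4 : δ ^ 4 = MulAut.conj (u * (muTilde ^ 2) u) * muTilde := by
      rw [← conj_mul_sq_mul_self muTilde_cube, ← h, ← pow_add]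
    rw [← h4]
    exact fix_le_fix_pow δ 4

/-- The equation says that `conj v` conjugates `conj u * muTilde` to `conj r * muTilde`. -/
theorem exists_twistedClass (u : W) : ∃ r v : W, codes r ∈ twistedClasses.map wordCodes ∧
    v * u = r * muTilde v := by
  have key := table_twistedClasses
  simp only [List.all_eq_true, List.any_eq_true, beq_iff_eq] at key
  obtain ⟨x, hx, y, hy, h⟩ := key _ (codes_mem_table u)
  obtain ⟨l, hl, rfl⟩ := List.mem_map.1 hx
  obtain ⟨v, rfl⟩ := exists_codes_eq hy
  refine ⟨(l.map simple).prod, v, (isCodes_word l).codes_eq ▸ hx, code_injective ?_⟩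
  rw [code_mul, code_mul, code_muTilde]
  change _ = mulCode (codes _).1 _
  rw [(isCodes_word l).codes_eq]
  exact h

theorem exists_conj_fix_of_twistedClass {r : W} (hr : codes r ∈ twistedClasses.map wordCodes) :
    ∃ v : W, (∀ g, r * muTilde g = g * r → v * g * v⁻¹ ∈ Fix muTilde) ∨
      (∀ g, r * muTilde g = g * r → v * g * v⁻¹ ∈ Fix rhoTilde) := by
  have key := table_centralizer
  simp only [List.all_eq_true, List.any_eq_true, List.mem_filter, Bool.or_eq_true,
    beq_iff_eq] at key
  obtain ⟨y, hy, h⟩ := key _ hr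
  obtain ⟨v, rfl⟩ := exists_codes_eq hy
  have hg : ∀ g, r * muTilde g = g * r →
      codes g ∈ table ∧ mulCode (codes r).1 (codes g).2.1 = mulCode (codes g).1 (codes r).1 :=
    fun g hg => ⟨codes_mem_table g, by
      have := congrArg code hg
      rwa [code_mul, code_mul, code_muTilde] at this⟩
  have hconj : ∀ g k : W, mulCode (codes k).1 (codes v).1 = mulCode (codes v).1 (codes g).1 →
      v * g * v⁻¹ = k := fun g k hk => by
    rw [mul_inv_eq_iff_eq_mul]
    apply code_injective
    rw [code_mul, code_mul]
    exact hk.symm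
  refine ⟨v, h.imp (fun h g hrg => ?_) (fun h g hrg => ?_)⟩
  · obtain ⟨z, ⟨hz, hz'⟩, hzv⟩ := h _ (hg g hrg)
    obtain ⟨k, rfl⟩ := exists_codes_eq hz
    rw [hconj g k hzv, mem_fix_muTilde_iff]
    exact hz'
  · obtain ⟨z, ⟨hz, hz'⟩, hzv⟩ := h _ (hg g hrg)
    obtain ⟨k, rfl⟩ := exists_codes_eq hz
    rw [hconj g k hzv, mem_fix_rhoTilde_iff]
    exact hz'

theorem exists_conj_fix (u : W) :
    ∃ v : W, (∀ g ∈ Fix (MulAut.conj u * muTilde), v * g * v⁻¹ ∈ Fix muTilde) ∨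
      (∀ g ∈ Fix (MulAut.conj u * muTilde), v * g * v⁻¹ ∈ Fix rhoTilde) := by
  obtain ⟨r, v, hr, h⟩ := exists_twistedClass u
  obtain ⟨w, hw⟩ := exists_conj_fix_of_twistedClass hr
  -- Conjugation by `v` carries the fixed group for `u` into the one for `r`.
  have hv : ∀ g ∈ Fix (MulAut.conj u * muTilde),
      r * muTilde (v * g * v⁻¹) = v * g * v⁻¹ * r := fun g hg => by
    have hg' : u * muTilde g = g * u := mul_inv_eq_iff_eq_mul.1 hg
    calc r * muTilde (v * g * v⁻¹) = r * muTilde v * muTilde g * (muTilde v)⁻¹ := by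
          simp [mul_assoc]
      _ = v * (u * muTilde g) * (muTilde v)⁻¹ := by rw [← h, mul_assoc v]
      _ = v * g * v⁻¹ * (v * u) * (muTilde v)⁻¹ := by rw [hg']; group
      _ = v * g * v⁻¹ * r := by rw [h]; group
  have hassoc : ∀ g, w * v * g * (w * v)⁻¹ = w * (v * g * v⁻¹) * w⁻¹ := fun g => by group
  refine ⟨w * v, hw.imp (fun hw g hg => ?_) (fun hw g hg => ?_)⟩
  · rw [hassoc]
    exact hw _ (hv g hg)
  · rw [hassoc]
    exact hw _ (hv g hg)

end WeylD4

/-! ### From fixed classes to fixed subgroups. -/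

namespace TrivialCohomology

variable {Γ G : Type*} [Group Γ] [TopologicalSpace Γ] [Group G]

/-- If a conjugate of a cocycle takes values in a subgroup `K`, then its class lies in the image of
`H¹(Γ, K)`. -/
theorem mk_mem_range_map_subtype (φ : Cocycle Γ G) (K : Subgroup G) (v : G)
    (h : ∀ γ, v * φ.1 γ * v⁻¹ ∈ K) :
    (Quotient.mk _ φ : H1 Γ G) ∈ Set.range (H1.map Γ K.subtype) := by
  let ψ : Γ →* K := ((MulAut.conj v).toMonoidHom.comp φ.1).codRestrict K h
  have hψ : IsLocallyConstant ψ := IsLocallyConstant.desc ψ (K.subtype)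
    (φ.2.comp (MulAut.conj v)) Subtype.val_injective
  refine ⟨Quotient.mk _ ⟨ψ, hψ⟩, Quotient.sound ⟨v⁻¹, fun γ => ?_⟩⟩
  change φ.1 γ = v⁻¹ * (v * φ.1 γ * v⁻¹) * v⁻¹⁻¹
  group

end TrivialCohomology

namespace WeylD4

open TrivialCohomology in
theorem mem_range_of_map_eq {Γ : Type*} [Group Γ] [TopologicalSpace Γ] {α : MulAut W}
    (hα : IsTrialitarian α) {c : H1 Γ W} (hc : H1.map Γ α.toMonoidHom c = c) :
    c ∈ Set.range (H1.map Γ (Fix muTilde).subtype) ∪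
      Set.range (H1.map Γ (Fix rhoTilde).subtype) := by
  induction c using Quotient.inductionOn with
  | h φ =>
  -- Here `hg` says `φ γ = g * α (φ γ) * g⁻¹`: each value of `φ` is fixed by `conj g * α`.
  obtain ⟨g, hg⟩ := Quotient.exact hc
  set β : MulAut W := MulAut.conj g * α with hβ
  have hφ : ∀ γ, φ.1 γ ∈ Fix β := fun γ => (hg γ).symm
  -- `β ^ 2` and `α ^ 2` differ by an inner automorphism. If they were inner, so would be `α = α ^
  -- 4`.
  have hβ2 : β ^ 2 ∉ (MulAut.conj : W →* MulAut W).range := by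
    rintro ⟨u, hu⟩
    refine hα.2 ?_
    have e : α ^ 2 = MulAut.conj ((g * α g)⁻¹ * u) := by
      rw [map_mul, hu, hβ]
      ext1 x
      simp [pow_two, mul_assoc]
    have h4 : α = α ^ 2 * α ^ 2 := by
      have h3 : α ^ 3 = 1 := hα.1 ▸ pow_orderOf_eq_one α
      rw [← pow_add, pow_succ, h3, one_mul]
    rw [h4, e, ← map_mul]
    exact ⟨_, rfl⟩
  obtain ⟨u, hu⟩ := exists_fix_le β hβ2
  obtain ⟨v, hv | hv⟩ := exists_conj_fix u
  · exact Or.inl (mk_mem_range_map_subtype φ _ v fun γ => hv _ (hu (hφ γ)))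
  · exact Or.inr (mk_mem_range_map_subtype φ _ v fun γ => hv _ (hu (hφ γ)))

end WeylD4

/-- Two groups are isomorphic if a finite list of pairs of labels is the graph of an
isomorphism. -/
theorem nonempty_mulEquiv_of_list {H K X Y : Type*} [Group H] [Group K] {c : H → X} {d : K → Y}
    (hc : Function.Injective c) (hd : Function.Injective d) (l : List (X × Y))
    (h_tot : ∀ h, ∃ k, (c h, d k) ∈ l) (h_surj : ∀ k, ∃ h, (c h, d k) ∈ l)
    (h_fun : ∀ p ∈ l, ∀ q ∈ l, p.1 = q.1 ↔ p.2 = q.2)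
    (h_mul : ∀ h h' k k', (c h, d k) ∈ l → (c h', d k') ∈ l → (c (h * h'), d (k * k')) ∈ l) :
    Nonempty (H ≃* K) := by
  choose f hf using h_tot
  refine ⟨MulEquiv.ofBijective (MonoidHom.mk' f fun x y => ?_) ⟨fun x y h => ?_, fun k => ?_⟩⟩
  · exact hd ((h_fun _ (hf (x * y)) _ (h_mul _ _ _ _ (hf x) (hf y))).1 rfl)
  · exact hc ((h_fun _ (hf x) _ (hf y)).2 (congrArg d h))
  · obtain ⟨h, hh⟩ := h_surj k
    exact ⟨h, hd ((h_fun _ (hf h) _ hh).1 rfl)⟩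

/-! ### The dihedral group of order 12. -/

namespace WeylD4

/-- The code of a power. -/
def powCode (a : ℕ) : ℕ → ℕ
  | 0 => 1672
  | n + 1 => mulCode a (powCode a n)

/-- The graph of an isomorphism of `Fix(μ̃)` with the dihedral group of order `12`. -/
def dihedralList : List (ℕ × DihedralGroup 6) :=
  -- Folding the diagram along `μ̃` gives the generators `s = simple 1` (code 1616) and `t = simple
  -- 0 * simple 2 * simple 3`. The code 3906 belongs to `s * t`, which has order 6.
  (List.finRange 6).flatMap fun n => [(powCode 3906 n, DihedralGroup.r n),
    (mulCode 1616 (powCode 3906 n), DihedralGroup.sr n)]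

theorem dihedralList_codes :
    ((table.filter fun g => g.2.1 == g.1).all fun g => dihedralList.any fun p => p.1 == g.1) ∧
    (dihedralList.all fun p => (table.filter fun g => g.2.1 == g.1).any fun g => g.1 == p.1) := by
  decide +kernel

theorem dihedralList_surjective : ∀ k : DihedralGroup 6, ∃ p ∈ dihedralList, p.2 = k := by
  decide +kernel

theorem dihedralList_functional : ∀ p ∈ dihedralList, ∀ q ∈ dihedralList,
    p.1 = q.1 ↔ p.2 = q.2 := by decide +kernel

theorem dihedralList_mul : ∀ p ∈ dihedralList, ∀ q ∈ dihedralList,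
    (mulCode p.1 q.1, p.2 * q.2) ∈ dihedralList := by decide +kernel

theorem nonempty_fix_muTilde_mulEquiv : Nonempty (Fix muTilde ≃* DihedralGroup 6) := by
  refine nonempty_mulEquiv_of_list (c := fun g : Fix muTilde => code (g : W)) (d := fun k => k)
    (code_injective.comp Subtype.val_injective) (fun _ _ h => h) dihedralList
    (fun g => ?_) (fun k => ?_) dihedralList_functional
    (fun h h' k k' hk hk' => ?_)
  · have key := dihedralList_codes.1
    simp only [List.all_eq_true, List.any_eq_true, List.mem_filter, beq_iff_eq] at key
    obtain ⟨p, hp, hpg⟩ := key _ ⟨codes_mem_table g, (mem_fix_muTilde_iff _).1 g.2⟩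
    exact ⟨p.2, by rwa [show (code (g : W), p.2) = p from Prod.ext hpg.symm rfl]⟩
  · have key := dihedralList_codes.2
    simp only [List.all_eq_true, List.any_eq_true, List.mem_filter, beq_iff_eq] at key
    obtain ⟨p, hp, rfl⟩ := dihedralList_surjective k
    obtain ⟨x, ⟨hx, hx'⟩, hxp⟩ := key p hp
    obtain ⟨g, rfl⟩ := exists_codes_eq hx
    exact ⟨⟨g, (mem_fix_muTilde_iff g).2 hx'⟩, by
      rwa [show (code g, p.2) = p from Prod.ext hxp rfl]⟩
  · simpa only [Subgroup.coe_mul, code_mul] using dihedralList_mul _ hk _ hk'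

/-! ### The binary tetrahedral group -/

/-- The product of the quaternions with coordinates `p` and `q`. -/
def quatMul (p q : ℤ × ℤ × ℤ × ℤ) : ℤ × ℤ × ℤ × ℤ :=
  (p.1 * q.1 - p.2.1 * q.2.1 - p.2.2.1 * q.2.2.1 - p.2.2.2 * q.2.2.2,
    p.1 * q.2.1 + p.2.1 * q.1 + p.2.2.1 * q.2.2.2 - p.2.2.2 * q.2.2.1,
    p.1 * q.2.2.1 - p.2.1 * q.2.2.2 + p.2.2.1 * q.1 + p.2.2.2 * q.2.1,
    p.1 * q.2.2.2 + p.2.1 * q.2.2.1 - p.2.2.1 * q.2.1 + p.2.2.2 * q.1)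

/-- The doubled coordinates of the product of the quaternions with doubled coordinates `p`
and `q`. -/
def halfQuatMul (p q : ℤ × ℤ × ℤ × ℤ) : ℤ × ℤ × ℤ × ℤ :=
  ((quatMul p q).1 / 2, (quatMul p q).2.1 / 2, (quatMul p q).2.2.1 / 2, (quatMul p q).2.2.2 / 2)

/-- The doubled coordinates of the Hurwitz units are those with integers `a, b, c, d` of the same
parity and `a² + b² + c² + d² = 4`. -/
def IsHurwitzUnit (p : ℤ × ℤ × ℤ × ℤ) : Prop :=
  p.1 % 2 = p.2.1 % 2 ∧ p.1 % 2 = p.2.2.1 % 2 ∧ p.1 % 2 = p.2.2.2 % 2 ∧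
    p.1 * p.1 + p.2.1 * p.2.1 + p.2.2.1 * p.2.2.1 + p.2.2.2 * p.2.2.2 = 4

instance : DecidablePred IsHurwitzUnit := fun _ => inferInstanceAs (Decidable (_ ∧ _ ∧ _ ∧ _))

/-- The quaternion with doubled coordinates `p`. -/
noncomputable def halfQuat (p : ℤ × ℤ × ℤ × ℤ) : ℍ[ℝ] :=
  ⟨p.1 / 2, p.2.1 / 2, p.2.2.1 / 2, p.2.2.2 / 2⟩

theorem halfQuat_injective : Function.Injective halfQuat := by
  rintro ⟨a, b, c, d⟩ ⟨a', b', c', d'⟩ h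
  have h0 := congrArg QuaternionAlgebra.re h
  have h1 := congrArg QuaternionAlgebra.imI h
  have h2 := congrArg QuaternionAlgebra.imJ h
  have h3 := congrArg QuaternionAlgebra.imK h
  simp only [halfQuat, div_left_inj' (two_ne_zero' ℝ), Int.cast_inj] at h0 h1 h2 h3
  subst h0 h1 h2 h3
  rfl

theorem normSq_halfQuat (p : ℤ × ℤ × ℤ × ℤ) : Quaternion.normSq (halfQuat p) =
    ((p.1 * p.1 + p.2.1 * p.2.1 + p.2.2.1 * p.2.2.1 + p.2.2.2 * p.2.2.2 : ℤ) : ℝ) / 4 := by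
  rw [Quaternion.normSq_def']
  simp only [halfQuat]
  push_cast
  ring

theorem exists_halfQuat_eq (k : binaryTetrahedral) :
    ∃ p, IsHurwitzUnit p ∧ halfQuat p = ((k : ℍ[ℝ]ˣ) : ℍ[ℝ]) := by
  obtain ⟨h, a, b, c, d, h1, h2, h3, e0, e1, e2, e3⟩ := k.2
  have e : halfQuat (a, b, c, d) = ((k : ℍ[ℝ]ˣ) : ℍ[ℝ]) := by
    ext <;> simp [halfQuat, e0, e1, e2, e3]
  refine ⟨(a, b, c, d), ⟨h1, h2, h3, ?_⟩, e⟩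
  rw [← e, normSq_halfQuat, div_eq_one_iff_eq (by norm_num)] at h
  exact_mod_cast h

/-- The doubled coordinates of an element of the binary tetrahedral group. -/
noncomputable def hurwitzCoords (k : binaryTetrahedral) : ℤ × ℤ × ℤ × ℤ :=
  (exists_halfQuat_eq k).choose

theorem isHurwitzUnit_hurwitzCoords (k : binaryTetrahedral) : IsHurwitzUnit (hurwitzCoords k) :=
  (exists_halfQuat_eq k).choose_spec.1

theorem halfQuat_hurwitzCoords (k : binaryTetrahedral) :
    halfQuat (hurwitzCoords k) = ((k : ℍ[ℝ]ˣ) : ℍ[ℝ]) :=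
  (exists_halfQuat_eq k).choose_spec.2

theorem hurwitzCoords_injective : Function.Injective hurwitzCoords := fun k k' h => by
  apply Subtype.ext
  apply Units.ext
  rw [← halfQuat_hurwitzCoords, h, halfQuat_hurwitzCoords]

theorem exists_hurwitzCoords_eq {p : ℤ × ℤ × ℤ × ℤ} (hp : IsHurwitzUnit p) :
    ∃ k, hurwitzCoords k = p := by
  obtain ⟨h1, h2, h3, h⟩ := hp
  have hn : Quaternion.normSq (halfQuat p) = 1 := by
    rw [normSq_halfQuat, h]
    norm_num
  have h0 : halfQuat p ≠ 0 := fun h => by simp [h] at hn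
  refine ⟨⟨Units.mk0 _ h0, hn, p.1, p.2.1, p.2.2.1, p.2.2.2, h1, h2, h3, rfl, rfl, rfl, rfl⟩, ?_⟩
  exact halfQuat_injective (halfQuat_hurwitzCoords _)

theorem halfQuat_mul {p q r : ℤ × ℤ × ℤ × ℤ}
    (h : quatMul p q = (2 * r.1, 2 * r.2.1, 2 * r.2.2.1, 2 * r.2.2.2)) :
    halfQuat p * halfQuat q = halfQuat r := by
  have e0 := congrArg (fun x : ℤ × ℤ × ℤ × ℤ => (x.1 : ℝ)) h
  have e1 := congrArg (fun x : ℤ × ℤ × ℤ × ℤ => (x.2.1 : ℝ)) h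
  have e2 := congrArg (fun x : ℤ × ℤ × ℤ × ℤ => (x.2.2.1 : ℝ)) h
  have e3 := congrArg (fun x : ℤ × ℤ × ℤ × ℤ => (x.2.2.2 : ℝ)) h
  simp only [quatMul] at e0 e1 e2 e3
  push_cast at e0 e1 e2 e3
  ext
  · rw [Quaternion.re_mul]
    simp only [halfQuat]
    linarith
  · rw [Quaternion.imI_mul]
    simp only [halfQuat]
    linarith
  · rw [Quaternion.imJ_mul]
    simp only [halfQuat]
    linarith
  · rw [Quaternion.imK_mul]
    simp only [halfQuat]
    linarith

/-- Componentwise products of codes and of quaternions with doubled coordinates. -/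
def mulPair (p q : ℕ × ℤ × ℤ × ℤ × ℤ) : ℕ × ℤ × ℤ × ℤ × ℤ :=
  (mulCode p.1 q.1, halfQuatMul p.2 q.2)

/-- The graph of an isomorphism of `Fix(ρ̃)` with the binary tetrahedral group, given by the images
of `i`, `j` and `-(1 + i + j + k) / 2`. -/
def hurwitzList : List (ℕ × ℤ × ℤ × ℤ × ℤ) :=
  -- In the basis `1, i, j, k`, the codes 574 and 343 are the right multiplications by `-j` and
  -- `-k`, which commute with the left multiplication `ρ`. The code 720 is the rotation `i ↦ j ↦ k ↦
  -- i`, conjugation by `(1 + i + j + k) / 2`; it has order 3, as does its partner `-(1 + i + j + k)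
  -- / 2`. Exponents up to 3, 1 and 2 give the 24 elements.
  (List.replicate 3 (574, 0, 2, 0, 0)).inits.flatMap fun x =>
    (List.replicate 1 (343, 0, 0, 2, 0)).inits.flatMap fun y =>
      (List.replicate 2 (720, -1, -1, -1, -1)).inits.map fun z =>
        (x ++ (y ++ z)).foldr mulPair (1672, 2, 0, 0, 0)

theorem hurwitzList_codes :
    ((table.filter fun g => g.2.2 == g.1).all fun g => hurwitzList.any fun p => p.1 == g.1) ∧
    (hurwitzList.all fun p => (table.filter fun g => g.2.2 == g.1).any fun g => g.1 == p.1) := by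
  decide +kernel

theorem hurwitzList_isHurwitzUnit : ∀ p ∈ hurwitzList, IsHurwitzUnit p.2 := by
  decide +kernel

theorem hurwitzList_functional : ∀ p ∈ hurwitzList, ∀ q ∈ hurwitzList,
    p.1 = q.1 ↔ p.2 = q.2 := by decide +kernel

/-- The second part ensures that the integer divisions by 2 in `halfQuatMul` are exact on the list,
so that they compute true quaternion products. -/
theorem hurwitzList_mul : ∀ p ∈ hurwitzList, ∀ q ∈ hurwitzList, mulPair p q ∈ hurwitzList ∧
    quatMul p.2 q.2 = (2 * (mulPair p q).2.1, 2 * (mulPair p q).2.2.1, 2 * (mulPair p q).2.2.2.1,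
      2 * (mulPair p q).2.2.2.2) := by decide +kernel

/-- The norm equation bounds each doubled coordinate by 2 in absolute value, which leaves finitely
many quadruples to check. -/
theorem hurwitzList_surjective {x : ℤ × ℤ × ℤ × ℤ} (hx : IsHurwitzUnit x) :
    ∃ p ∈ hurwitzList, p.2 = x := by
  have key : ∀ a ∈ [-2, -1, 0, 1, 2], ∀ b ∈ [-2, -1, 0, 1, 2], ∀ c ∈ [-2, -1, 0, 1, 2],
      ∀ d ∈ [-2, -1, 0, 1, 2], IsHurwitzUnit (a, b, c, d) →
        ∃ p ∈ hurwitzList, p.2 = (a, b, c, d) := by decide +kernel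
  have small : ∀ n : ℤ, n * n ≤ 4 → n ∈ [-2, -1, 0, 1, 2] := fun n hn => by
    have h1 : n ≤ 2 := by nlinarith
    have h2 : -2 ≤ n := by nlinarith
    interval_cases n <;> decide
  obtain ⟨a, b, c, d⟩ := x
  have h : a * a + b * b + c * c + d * d = 4 := hx.2.2.2
  have ha := mul_self_nonneg a
  have hb := mul_self_nonneg b
  have hc := mul_self_nonneg c
  have hd := mul_self_nonneg d
  exact key a (small a (by linarith)) b (small b (by linarith)) c (small c (by linarith)) d
    (small d (by linarith)) hx

theorem nonempty_fix_rhoTilde_mulEquiv : Nonempty (Fix rhoTilde ≃* binaryTetrahedral) := by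
  refine nonempty_mulEquiv_of_list (c := fun g : Fix rhoTilde => code (g : W))
    (code_injective.comp Subtype.val_injective) hurwitzCoords_injective hurwitzList
    (fun g => ?_) (fun k => ?_) hurwitzList_functional
    (fun h h' k k' hk hk' => ?_)
  · have key := hurwitzList_codes.1
    simp only [List.all_eq_true, List.any_eq_true, List.mem_filter, beq_iff_eq] at key
    obtain ⟨p, hp, hpg⟩ := key _ ⟨codes_mem_table g, (mem_fix_rhoTilde_iff _).1 g.2⟩
    obtain ⟨k, hk⟩ := exists_hurwitzCoords_eq (hurwitzList_isHurwitzUnit p hp)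
    exact ⟨k, by rwa [show (code (g : W), hurwitzCoords k) = p from Prod.ext hpg.symm hk]⟩
  · have key := hurwitzList_codes.2
    simp only [List.all_eq_true, List.any_eq_true, List.mem_filter, beq_iff_eq] at key
    obtain ⟨p, hp, hpk⟩ := hurwitzList_surjective (isHurwitzUnit_hurwitzCoords k)
    obtain ⟨x, ⟨hx, hx'⟩, hxp⟩ := key p hp
    obtain ⟨g, rfl⟩ := exists_codes_eq hx
    exact ⟨⟨g, (mem_fix_rhoTilde_iff g).2 hx'⟩, by
      rwa [show (code g, hurwitzCoords k) = p from Prod.ext hxp hpk.symm]⟩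
  · obtain ⟨h1, h2⟩ := hurwitzList_mul _ hk _ hk'
    have e : hurwitzCoords (k * k') = halfQuatMul (hurwitzCoords k) (hurwitzCoords k') := by
      apply halfQuat_injective
      rw [halfQuat_hurwitzCoords, Subgroup.coe_mul, Units.val_mul, ← halfQuat_hurwitzCoords,
        ← halfQuat_hurwitzCoords]
      exact halfQuat_mul h2
    simp only [Subgroup.coe_mul, code_mul, e]
    exact h1

end WeylD4

theorem mainTheorem2 (F Fs : Type*) [Field F] [Field Fs] [Algebra F Fs] [IsSepClosure F Fs] :
    (∀ α : MulAut WeylD4.W, WeylD4.IsTrialitarian α →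
      {c : TrivialCohomology.H1 Gal(Fs/F) WeylD4.W |
          TrivialCohomology.H1.map Gal(Fs/F) α.toMonoidHom c = c} ⊆
        Set.range (TrivialCohomology.H1.map Gal(Fs/F) (WeylD4.Fix WeylD4.muTilde).subtype) ∪
          Set.range (TrivialCohomology.H1.map Gal(Fs/F) (WeylD4.Fix WeylD4.rhoTilde).subtype)) ∧
      Nonempty (WeylD4.Fix WeylD4.muTilde ≃* DihedralGroup 6) ∧
      Nonempty (WeylD4.Fix WeylD4.rhoTilde ≃* binaryTetrahedral) := by
  exact ⟨fun _ hα _ hc => WeylD4.mem_range_of_map_eq hα hc, WeylD4.nonempty_fix_muTilde_mulEquiv,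
    WeylD4.nonempty_fix_rhoTilde_mulEquiv⟩
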